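/- **Setting.** An instance consists of two disjoint sets $A$ and $B$ of $n$ agents each, a strict total order $\prec_a$ on $B$ for each $a\in A$ and a strict total order $\prec_b$ on $A$ for each $b\in B$ ($x\prec_c y$ means that $c$ prefers $x$ to $y$). A matching is a bijection $M$ between $A$ and $B$; it is *stable* if there is no pair $(a,b)\in A\times B$ with $M(a)\neq b$, $b\prec_a M(a)$ and $a\prec_b M(b)$. A stable matching is *$B$-optimal* if no agent in $B$ prefers another stable matching to it. The preferences of $A$ are known; those of $B$ are initially unknown and can be accessed only by comparison queries $\mathrm{prefer}(b,a_1,a_2)$, which reveal whether $b$ prefers $a_1$ to $a_2$. A deterministic online algorithm makes adaptively chosen comparison queries until it stops with an output. An algorithm for *finding* must output the $B$-optimal stable matching on every instance; an algorithm for *verifying* is also given a matching $M$ and must decide correctly, for every instance and every $M$, whether $M$ is stable and $B$-optimal. A randomized online algorithm is a probability distribution over such (always correct) deterministic algorithms, and its cost on an input is the expected number of queries. $\mathrm{OPT}$ of an instance is the minimum size of a set of comparison queries whose answers on this instance prove, for some matching (for verifying: for the given matching $M$), that it is stable and $B$-optimal, i.e. this matching is stable and $B$-optimal for all preferences of $B$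 that are consistent with these answers. An algorithm is *$\rho$-competitive* on instances of size $n$ if on each of them its (expected) number of queries is at most $\rho\cdot\mathrm{OPT}$; for verifying, only inputs where $M$ is indeed stable and $B$-optimal are considered. Its *competitive ratio* is the infimum of all such $\rho$ ($\infty$ if there is none). **Theorem.** In the comparison-query model, every deterministic or randomized online algorithm for finding the $B$-optimal stable matching, and every deterministic or randomized online algorithm for verifying that a given matching is stable and $B$-optimal, has competitive ratio $\Omega(n)$. That is, there are a constant $c>0$ and an $N\in\mathbb N$ such that for all $n\ge N$ each such algorithm has competitive ratio at least $c\,n$ on instances with $|A|=|B|=n$. -/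

import Mathlib

open scoped ENNReal NNReal

namespace StableQuery

/-- A preference list over a set `X` of agents: a strict total order on `X`.
`P.prefers x y` means that `x` is preferred to `y`. -/
@[ext]
structure Pref (X : Type) where
  prefers : X → X → Prop
  irrefl : ∀ x, ¬ prefers x x
  trans : ∀ x y z, prefers x y → prefers y z → prefers x z
  total : ∀ x y, x ≠ y → prefers x y ∨ prefers y x

/-- The preference lists of the agents in `X`, each being a list of all agents in `Y`. -/
abbrev Profile (X Y : Type) : Type := X → Pref Y

variable {A B O : Type}

/-- `(a, b)` is a blocking pair in the matching `M`, where a matching is a bijection `A ≃ B`. -/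
def IsBlockingPair (PA : Profile A B) (PB : Profile B A) (M : A ≃ B) (a : A) (b : B) : Prop :=
  M a ≠ b ∧ (PA a).prefers b (M a) ∧ (PB b).prefers a (M.symm b)

/-- A matching is stable if it has no blocking pair. -/
def IsStable (PA : Profile A B) (PB : Profile B A) (M : A ≃ B) : Prop :=
  ¬ ∃ a b, IsBlockingPair PA PB M a b

/-- `M` is a `B`-optimal stable matching: it is stable, and no agent in `B` prefers another stable
matching to `M`. -/
def IsBOptimal (PA : Profile A B) (PB : Profile B A) (M : A ≃ B) : Prop :=
  IsStable PA PB M ∧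
    ∀ M' : A ≃ B, IsStable PA PB M' → ∀ b, ¬ (PB b).prefers (M'.symm b) (M.symm b)

/-! ### Adaptive query strategies -/

/-- A deterministic adaptive strategy that makes comparison queries and finally outputs an element
of `O`: `query b a₁ a₂ t f` makes the query `prefer(b, a₁, a₂)` and continues with `t` if `b` prefers
`a₁` to `a₂`, and with `f` otherwise. -/
inductive Strategy (A B O : Type) : Type
  | output (o : O) : Strategy A B O
  | query (b : B) (a₁ a₂ : A) (t f : Strategy A B O) : Strategy A B O

open Classical in
/-- The output of a strategy if the (hidden) preference lists of the agents in `B` are `PB`. -/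
noncomputable def Strategy.run (PB : Profile B A) : Strategy A B O → O
  | .output o => o
  | .query b a₁ a₂ t f => if (PB b).prefers a₁ a₂ then t.run PB else f.run PB

open Classical in
/-- The number of queries that a strategy makes if the preference lists of `B` are `PB`. -/
noncomputable def Strategy.numQueries (PB : Profile B A) : Strategy A B O → ℕ
  | .output _ => 0
  | .query b a₁ a₂ t f =>
      1 + if (PB b).prefers a₁ a₂ then t.numQueries PB else f.numQueries PB

/-! ### Optimal number of queries -/

/-- The preference lists `PB'` give the same answers as `PB` to all comparison queries in `Q`, where
`(b, a₁, a₂)` stands for the query `prefer(b, a₁, a₂)`. -/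
def SameAnswers (Q : Finset (B × A × A)) (PB PB' : Profile B A) : Prop :=
  ∀ q ∈ Q, (PB' q.1).prefers q.2.1 q.2.2 ↔ (PB q.1).prefers q.2.1 q.2.2

/-- The answers to the queries in `Q` on the instance `(PA, PB)` prove that `M` is stable and
`B`-optimal: this is so for all preference lists of `B` that are consistent with these answers. -/
def Proves (PA : Profile A B) (PB : Profile B A) (Q : Finset (B × A × A)) (M : A ≃ B) : Prop :=
  ∀ PB', SameAnswers Q PB PB' → IsBOptimal PA PB' M

/-- The minimum number of queries that suffice to output a provably correct `B`-optimal stable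
matching for the instance `(PA, PB)`. -/
noncomputable def optFind (PA : Profile A B) (PB : Profile B A) : ℕ∞ :=
  ⨅ (Q : Finset (B × A × A)) (_ : ∃ M, Proves PA PB Q M), (Q.card : ℕ∞)

/-- The minimum number of queries that suffice to prove that `M` is stable and `B`-optimal for the
instance `(PA, PB)`. -/
noncomputable def optVerify (PA : Profile A B) (PB : Profile B A) (M : A ≃ B) : ℕ∞ :=
  ⨅ (Q : Finset (B × A × A)) (_ : Proves PA PB Q M), (Q.card : ℕ∞)

/-! ### Finding a `B`-optimal stable matching -/

/-- A deterministic online algorithm for finding a `B`-optimal stable matching. It knows the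
preference lists of `A` and accesses those of `B` only through comparison queries. -/
abbrev FindAlg (A B : Type) : Type := Profile A B → Strategy A B (A ≃ B)

/-- The algorithm outputs a `B`-optimal stable matching on every instance. -/
def FindAlg.IsCorrect (alg : FindAlg A B) : Prop :=
  ∀ PA PB, IsBOptimal PA PB ((alg PA).run PB)

/-- The number of queries made by the algorithm on an instance. -/
noncomputable def FindAlg.cost (alg : FindAlg A B) (PA : Profile A B) (PB : Profile B A) : ℝ≥0∞ :=
  ((alg PA).numQueries PB : ℝ≥0∞)

/-- A randomized online algorithm is a probability distribution over deterministic ones. For finite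
`A` and `B` there are only countably many of those. -/
abbrev RandFindAlg (A B : Type) : Type := PMF (FindAlg A B)

/-- The algorithm never makes an error: each deterministic algorithm that can be drawn is correct. -/
def RandFindAlg.IsCorrect (alg : RandFindAlg A B) : Prop :=
  ∀ d ∈ PMF.support alg, FindAlg.IsCorrect d

/-- The expected number of queries made by the algorithm on an instance. -/
noncomputable def RandFindAlg.cost (alg : RandFindAlg A B)
    (PA : Profile A B) (PB : Profile B A) : ℝ≥0∞ :=
  ∑' d : FindAlg A B, alg d * FindAlg.cost d PA PB

/-- An algorithm with the given (expected) number of queries on each instance is `ρ`-competitive for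
finding a `B`-optimal stable matching. -/
def IsFindCompetitive (cost : Profile A B → Profile B A → ℝ≥0∞) (ρ : ℝ≥0) : Prop :=
  ∀ PA PB, cost PA PB ≤ (ρ : ℝ≥0∞) * (optFind PA PB : ℝ≥0∞)

/-- The competitive ratio for finding: the infimum of all `ρ` such that the algorithm is
`ρ`-competitive (infinite if there is none). -/
noncomputable def findRatio (cost : Profile A B → Profile B A → ℝ≥0∞) : ℝ≥0∞ :=
  ⨅ (ρ : ℝ≥0) (_ : IsFindCompetitive cost ρ), (ρ : ℝ≥0∞)

/-! ### Verifying that a given matching is stable and `B`-optimal -/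

/-- A deterministic online algorithm that decides whether a given matching is stable and
`B`-optimal. It knows the matching and the preference lists of `A`. -/
abbrev VerifyAlg (A B : Type) : Type := Profile A B → (A ≃ B) → Strategy A B Bool

/-- On every instance and matching, the algorithm decides correctly. -/
def VerifyAlg.IsCorrect (alg : VerifyAlg A B) : Prop :=
  ∀ PA PB M, (alg PA M).run PB = true ↔ IsBOptimal PA PB M

/-- The number of queries made by the algorithm on an instance with a given matching. -/
noncomputable def VerifyAlg.cost (alg : VerifyAlg A B)
    (PA : Profile A B) (PB : Profile B A) (M : A ≃ B) : ℝ≥0∞ :=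
  ((alg PA M).numQueries PB : ℝ≥0∞)

/-- A randomized verification algorithm: a distribution over deterministic ones. -/
abbrev RandVerifyAlg (A B : Type) : Type := PMF (VerifyAlg A B)

/-- The algorithm never makes an error: each deterministic algorithm that can be drawn is correct. -/
def RandVerifyAlg.IsCorrect (alg : RandVerifyAlg A B) : Prop :=
  ∀ d ∈ PMF.support alg, VerifyAlg.IsCorrect d

/-- The expected number of queries made by the algorithm on an instance with a given matching. -/
noncomputable def RandVerifyAlg.cost (alg : RandVerifyAlg A B)
    (PA : Profile A B) (PB : Profile B A) (M : A ≃ B) : ℝ≥0∞ :=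
  ∑' d : VerifyAlg A B, alg d * VerifyAlg.cost d PA PB M

/-- `ρ`-competitiveness for verification. The number of queries is compared to the optimum only for
inputs where the given matching is indeed stable and `B`-optimal. -/
def IsVerifyCompetitive (cost : Profile A B → Profile B A → (A ≃ B) → ℝ≥0∞) (ρ : ℝ≥0) : Prop :=
  ∀ PA PB M, IsBOptimal PA PB M →
    cost PA PB M ≤ (ρ : ℝ≥0∞) * (optVerify PA PB M : ℝ≥0∞)

/-- The competitive ratio for verification: the infimum of all `ρ` such that the algorithm is
`ρ`-competitive (infinite if there is none). -/
noncomputable def verifyRatio (cost : Profile A B → Profile B A → (A ≃ B) → ℝ≥0∞) : ℝ≥0∞ :=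
  ⨅ (ρ : ℝ≥0) (_ : IsVerifyCompetitive cost ρ), (ρ : ℝ≥0∞)

end StableQuery

namespace StableQuery

/-! Identify both sides through common roles and let every agent of `A` rank its own partner first.
The identity matching is then always stable, so it is `B`-optimal exactly when no other stable
matching improves an agent of `B`.

Whether one exists depends on a hidden map `c`. The agents `p i` and `q i` would gain on the
`B`-side by swapping partners, and the only possible obstacle is an agent `low j` that accepts `p
i`. If `c i = some j` for every `i`, a chain of forced assignments (sink, then `low`, then `p`, then
`q`) makes the identity the unique stable matching (`eq_refl_of_isStable`), and at most `2n` answers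
certify this. If `c i = none` for some `i`, the swap is stable and the identity is not optimal
(`not_isBOptimal_refl_hard`).

A correct algorithm must therefore locate the acceptor of each `p i`, and a query tests one
candidate `j`. For uniform `c` this costs about `|K|/2` queries involving `p i` on average
(`Strategy.card_mul_le_sum_numQueriesOf`). A query involves at most two agents of `A`, so the
average total is at least `|P|(|K|+1)/4`, which is quadratic in `n`. Averaging over `c` also handles
randomized algorithms, as in Yao's principle. -/

/-- The preference list that sorts the agents by tier, breaking ties by a fixed order. -/
def Pref.ofTier {X : Type} [LinearOrder X] (g : X → ℕ) : Pref X where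
  prefers x y := g x < g y ∨ (g x = g y ∧ x < y)
  irrefl x := by simp
  trans x y z := by
    rintro (h | ⟨h, h'⟩) (k | ⟨k, k'⟩)
    · exact .inl (h.trans k)
    · exact .inl (by omega)
    · exact .inl (by omega)
    · exact .inr ⟨h.trans k, h'.trans k'⟩
  total x y hxy := by
    rcases lt_trichotomy (g x) (g y) with h | h | h
    · exact .inl (.inl h)
    · rcases lt_or_gt_of_ne hxy with h' | h'
      · exact .inl (.inr ⟨h, h'⟩)
      · exact .inr (.inr ⟨h.symm, h'⟩)
    · exact .inr (.inl h)

theorem Pref.ofTier_of_lt {X : Type} [LinearOrder X] {g : X → ℕ} {x y : X} (h : g x < g y) :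
    (Pref.ofTier g).prefers x y := .inl h

theorem Pref.not_ofTier_of_lt {X : Type} [LinearOrder X] {g : X → ℕ} {x y : X} (h : g y < g x) :
    ¬ (Pref.ofTier g).prefers x y := by
  rintro (h' | ⟨h', -⟩) <;> omega

/-! ### Roles and tiers of the hard instances -/

/-- The agents of the hard instances. Both sides consist of agents with the same roles. -/
inductive Role (P K : Type) : Type
  | p (i : P)
  | q (i : P)
  | low (j : K)
  | sink

namespace Role

variable {P K : Type}

/-- Roles as a sum type. -/
def equivSum : Role P K ≃ (P ⊕ P) ⊕ Option K where
  toFun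
    | .p i => .inl (.inl i)
    | .q i => .inl (.inr i)
    | .low j => .inr (some j)
    | .sink => .inr none
  invFun
    | .inl (.inl i) => .p i
    | .inl (.inr i) => .q i
    | .inr (some j) => .low j
    | .inr none => .sink
  left_inv := by rintro (_ | _ | _ | _) <;> rfl
  right_inv := by rintro ((_ | _) | (_ | _)) <;> rfl

open Classical in
/-- The tier of `y` in the list of the agent `x ∈ A`, for `x ≠ y`. -/
noncomputable def otherTier : Role P K → Role P K → ℕ
  | .p _, .low _ => 1
  | .p i, .q i' => if i = i' then 2 else 3
  | .q i, .p i' => if i = i' then 1 else 3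
  | .low _, .sink => 1
  | _, _ => 3

open Classical in
/-- The tier of `y` in the list of the agent `x ∈ A`. -/
noncomputable def tierA (x y : Role P K) : ℕ := if y = x then 0 else otherTier x y

/-- The agents other than its partner that `b ∈ B` prefers to its partner; `c i` is the agent in
`B` of role `low` that prefers `p i` to its partner, if there is one. -/
def Accepts (c : P → Option K) : Role P K → Role P K → Prop
  | .sink, _ => True
  | .p i, .q i' => i = i'
  | .q i, .p i' => i = i'
  | .low j, .p i => c i = some j
  | _, _ => False

open Classical in
/-- The tier of `a` in the list of the agent `b ∈ B`. -/
noncomputable def tierB (c : P → Option K) (b a : Role P K) : ℕ :=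
  if a = b then 1 else if Accepts c b a then 0 else 2

theorem otherTier_pos (x y : Role P K) : 0 < otherTier x y := by
  unfold otherTier; split <;> (try split) <;> omega

end Role

/-! ### Stable matchings of the hard instances and short certificates -/

section HardInstance

variable {X P K : Type} [LinearOrder X] (e : X ≃ Role P K)

/-- The preference lists of `A` in the hard instances. -/
noncomputable def hardA : Profile X X := fun x => .ofTier fun y => Role.tierA (e x) (e y)

/-- The preference lists of `B` in the hard instances. -/
noncomputable def hardB (c : P → Option K) : Profile X X :=
  fun b => .ofTier fun a => Role.tierB c (e b) (e a)

theorem hardA_own {x y : X} (h : y ≠ x) : (hardA e x).prefers x y := by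
  apply Pref.ofTier_of_lt
  simpa [Role.tierA, h] using Role.otherTier_pos _ _

theorem hardA_not_prefers_own (x y : X) : ¬ (hardA e x).prefers y x := by
  by_cases h : y = x
  · subst h; exact Pref.irrefl _ _
  · exact fun h' => Pref.irrefl _ _ (Pref.trans _ _ _ _ h' (hardA_own e h))

theorem isStable_refl_hardA (PB : Profile X X) : IsStable (hardA e) PB (Equiv.refl X) := by
  rintro ⟨a, b, -, h, -⟩
  exact hardA_not_prefers_own e a b h

/-- For each agent other than the sink, an agent in `B` that accepts it. -/
def acceptor (c : P → K) (x : X) : X :=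
  e.symm <| match e x with
    | .p i => .low (c i)
    | .q i => .p i
    | .low _ => .sink
    | .sink => .sink

/-- If every agent but the sink is accepted by its acceptor, and nobody accepts the sink, then there
is only one stable matching. -/
theorem eq_refl_of_isStable (c : P → K) {PB : Profile X X}
    (hacc : ∀ x, x ≠ e.symm .sink → (PB (acceptor e c x)).prefers x (acceptor e c x))
    (hsink : ∀ x, x ≠ e.symm .sink → (PB x).prefers x (e.symm .sink))
    {M : X ≃ X} (hM : IsStable (hardA e) PB M) : M = Equiv.refl X := by
  -- Otherwise `b` and its own partner, who ranks `b` first, would block.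
  have hweak : ∀ b, M b ≠ b → (PB b).prefers (M.symm b) b := by
    intro b hb
    have hne : M.symm b ≠ b := fun h => hb (by rw [Equiv.symm_apply_eq] at h; exact h.symm)
    refine ((PB b).total _ _ hne).resolve_right fun h => hM ⟨b, b, hb, hardA_own e hb, h⟩
  have hinv : ∀ {x}, M x = x → M.symm x = x := fun h => by rw [Equiv.symm_apply_eq, h]
  -- One link of the chain: once the acceptor of `x` is known to keep its own partner, a displaced
  -- `x` would block with it.
  have key : ∀ x, x ≠ e.symm .sink → M (acceptor e c x) = acceptor e c x →
      (M x ≠ x → (hardA e x).prefers (acceptor e c x) (M x)) → M x = x := by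
    intro x hx hy hpref
    by_contra hne
    have hxy : acceptor e c x ≠ x := fun h => hne (h ▸ hy)
    refine hM ⟨x, acceptor e c x, ?_, hpref hne, ?_⟩
    · intro h
      exact hxy (M.injective (hy.trans h.symm))
    · rw [hinv hy]; exact hacc x hx
  have h0 : M (e.symm .sink) = e.symm .sink := by
    by_contra hne
    have h1 := hweak (M (e.symm .sink)) (fun h => hne (M.injective h))
    rw [Equiv.symm_apply_apply] at h1
    exact (PB _).irrefl _ ((PB _).trans _ _ _ (hsink _ hne) h1)
  have hlow : ∀ j, M (e.symm (.low j)) = e.symm (.low j) := by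
    intro j
    refine key _ (by simp) (by simpa [acceptor] using h0) fun hne => ?_
    apply Pref.ofTier_of_lt
    have h2 : M (e.symm (.low j)) ≠ e.symm .sink := fun h => by
      simpa using M.injective (h.trans h0.symm)
    have h3 : e (M (e.symm (.low j))) ≠ .low j := fun h => hne (e.eq_symm_apply.2 h)
    have h4 : e (M (e.symm (.low j))) ≠ .sink := fun h => h2 (by rw [← h]; simp)
    revert h3 h4
    generalize e (M (e.symm (.low j))) = r
    intro h3 h4
    cases r <;> simp_all [acceptor, Role.tierA, Role.otherTier]
  have hp : ∀ i, M (e.symm (.p i)) = e.symm (.p i) := by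
    intro i
    refine key _ (by simp) (by simpa [acceptor] using hlow _) fun hne => ?_
    apply Pref.ofTier_of_lt
    have h3 : e (M (e.symm (.p i))) ≠ .p i := fun h => hne (e.eq_symm_apply.2 h)
    have h4 : ∀ j, e (M (e.symm (.p i))) ≠ .low j := fun j h => by
      have h5 : M (e.symm (.p i)) = e.symm (.low j) := by rw [← h]; simp
      simpa using M.injective (h5.trans (hlow j).symm)
    revert h3 h4
    generalize e (M (e.symm (.p i))) = r
    intro h3 h4
    cases r <;> simp_all [acceptor, Role.tierA, Role.otherTier]
    split <;> omega
  have hq : ∀ i, M (e.symm (.q i)) = e.symm (.q i) := by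
    intro i
    refine key _ (by simp) (by simpa [acceptor] using hp _) fun hne => ?_
    apply Pref.ofTier_of_lt
    have h3 : e (M (e.symm (.q i))) ≠ .q i := fun h => hne (e.eq_symm_apply.2 h)
    have h4 : e (M (e.symm (.q i))) ≠ .p i := fun h => by
      have h5 : M (e.symm (.q i)) = e.symm (.p i) := by rw [← h]; simp
      simpa using M.injective (h5.trans (hp i).symm)
    revert h3 h4
    generalize e (M (e.symm (.q i))) = r
    intro h3 h4
    cases r <;> simp_all [acceptor, Role.tierA, Role.otherTier]
    rw [if_neg (Ne.symm h4)]; omega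
  ext x
  obtain ⟨r, rfl⟩ := e.symm.surjective x
  cases r <;> simp [*]

theorem hardB_acceptor (c : P → K) {x : X} (hx : x ≠ e.symm .sink) :
    (hardB e (some ∘ c) (acceptor e c x)).prefers x (acceptor e c x) := by
  obtain ⟨r, rfl⟩ := e.symm.surjective x
  apply Pref.ofTier_of_lt
  cases r <;> simp_all [acceptor, Role.tierB, Role.Accepts]

theorem hardB_sink (c : P → Option K) {x : X} (hx : x ≠ e.symm .sink) :
    (hardB e c x).prefers x (e.symm .sink) := by
  obtain ⟨r, rfl⟩ := e.symm.surjective x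
  apply Pref.ofTier_of_lt
  cases r <;> simp_all [Role.tierB, Role.Accepts]

open Classical in
/-- A set of queries that proves the optimality of the identity matching. -/
noncomputable def certificate [Fintype X] (c : P → K) : Finset (X × X × X) :=
  Finset.univ.image (fun x => (acceptor e c x, x, acceptor e c x)) ∪
    Finset.univ.image (fun x => (x, x, e.symm .sink))

theorem certificate_card_le [Fintype X] (c : P → K) :
    (certificate e c).card ≤ 2 * Fintype.card X := by
  refine (Finset.card_union_le _ _).trans ?_
  have h1 := Finset.card_image_le (s := Finset.univ)
    (f := fun x : X => (acceptor e c x, x, acceptor e c x))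
  have h2 := Finset.card_image_le (s := Finset.univ)
    (f := fun x : X => (x, x, e.symm Role.sink))
  rw [Finset.card_univ] at h1 h2
  rw [two_mul]
  convert Nat.add_le_add h1 h2

/-- The queried comparisons are precisely the hypotheses of `eq_refl_of_isStable`, so uniqueness
holds for every consistent profile. The queries generated by the sink itself are trivial and only
pad the count. -/
theorem proves_certificate [Fintype X] (c : P → K) :
    Proves (hardA e) (hardB e (some ∘ c)) (certificate e c) (Equiv.refl X) := by
  intro PB hPB
  refine ⟨isStable_refl_hardA e PB, fun M hM b => ?_⟩
  rw [eq_refl_of_isStable e c (fun x hx => ?_) (fun x hx => ?_) hM]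
  · exact (PB b).irrefl _
  · exact (hPB (acceptor e c x, x, acceptor e c x) (by simp [certificate])).2
      (hardB_acceptor e c hx)
  · exact (hPB (x, x, e.symm .sink) (by simp [certificate])).2 (hardB_sink e _ hx)

theorem optVerify_hard_le [Fintype X] (c : P → K) :
    optVerify (hardA e) (hardB e (some ∘ c)) (Equiv.refl X) ≤ (2 * Fintype.card X : ℕ) :=
  (iInf₂_le (certificate e c) (proves_certificate e c)).trans
    (by exact_mod_cast certificate_card_le e c)

theorem optFind_hard_le [Fintype X] (c : P → K) :
    optFind (hardA e) (hardB e (some ∘ c)) ≤ (2 * Fintype.card X : ℕ) :=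
  (iInf₂_le (certificate e c) ⟨_, proves_certificate e c⟩).trans
    (by exact_mod_cast certificate_card_le e c)

theorem isBOptimal_hard_iff_of_total (c : P → K) (M : X ≃ X) :
    IsBOptimal (hardA e) (hardB e (some ∘ c)) M ↔ M = Equiv.refl X := by
  have huniq : ∀ M' : X ≃ X, IsStable (hardA e) (hardB e (some ∘ c)) M' → M' = Equiv.refl X :=
    fun M' hM' => eq_refl_of_isStable e c (fun _ hx => hardB_acceptor e c hx)
      (fun _ hx => hardB_sink e _ hx) hM'
  refine ⟨fun h => huniq M h.1, ?_⟩
  rintro rfl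
  refine ⟨isStable_refl_hardA e _, fun M' hM' b => ?_⟩
  rw [huniq M' hM']
  exact Pref.irrefl _ _

/-- Swapping the partners of `p i` and `q i` is stable and improves both of these agents of `B`. -/
theorem not_isBOptimal_refl_hard {c : P → Option K} {i : P} (hi : c i = none) :
    ¬ IsBOptimal (hardA e) (hardB e c) (Equiv.refl X) := by
  classical
  intro hopt
  have hpq : (hardB e c (e.symm (.p i))).prefers (e.symm (.q i)) (e.symm (.p i)) := by
    apply Pref.ofTier_of_lt
    simp [Role.tierB, Role.Accepts]
  have hqp : (hardB e c (e.symm (.q i))).prefers (e.symm (.p i)) (e.symm (.q i)) := by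
    apply Pref.ofTier_of_lt
    simp [Role.tierB, Role.Accepts]
  refine hopt.2 (Equiv.swap (e.symm (.p i)) (e.symm (.q i))) ?_ (e.symm (.p i)) (by simpa using hpq)
  rintro ⟨a, b, hne, hA, hB⟩
  rw [Equiv.symm_swap] at hB
  by_cases hap : a = e.symm (.p i)
  · subst hap
    rw [Equiv.swap_apply_left] at hne hA
    obtain ⟨r, rfl⟩ := e.symm.surjective b
    cases r with
    | p i' =>
      by_cases h : i' = i
      · subst h
        rw [Equiv.swap_apply_left] at hB
        exact Pref.irrefl _ _ (Pref.trans _ _ _ _ hB hpq)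
      · refine Pref.not_ofTier_of_lt ?_ hA
        simp [Role.tierA, Role.otherTier, h]
    | q i' =>
      refine Pref.not_ofTier_of_lt ?_ hA
      have h : i ≠ i' := fun h => hne (by rw [h])
      simp [Role.tierA, Role.otherTier, h]
    -- The only use of `c i = none`: `p i` would rather have `low j`, but no `low j` accepts it.
    | low j =>
      rw [Equiv.swap_apply_of_ne_of_ne (by simp) (by simp)] at hB
      refine Pref.not_ofTier_of_lt ?_ hB
      simp [Role.tierB, Role.Accepts, hi]
    | sink =>
      refine Pref.not_ofTier_of_lt ?_ hA
      simp [Role.tierA, Role.otherTier]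
  · by_cases haq : a = e.symm (.q i)
    · subst haq
      rw [Equiv.swap_apply_right] at hne hA
      obtain ⟨r, rfl⟩ := e.symm.surjective b
      by_cases h : r = .q i
      · subst h
        rw [Equiv.swap_apply_right] at hB
        exact Pref.irrefl _ _ (Pref.trans _ _ _ _ hB hqp)
      · have h' : r ≠ .p i := fun h => hne (by rw [h])
        refine Pref.not_ofTier_of_lt ?_ hA
        cases r <;> simp_all [Role.tierA, Role.otherTier]
    · rw [Equiv.swap_apply_of_ne_of_ne hap haq] at hA
      exact hardA_not_prefers_own e a b hA

/-- Changing whether `low j` accepts `p i` affects only queries to `low j` that involve `p i`. -/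
theorem hardB_update_prefers_iff [DecidableEq P] (c : P → Option K) (i : P) (j : K) {b x y : X}
    (h : ¬ (b = e.symm (.low j) ∧ (x = e.symm (.p i) ∨ y = e.symm (.p i)))) :
    (hardB e (Function.update c i (some j)) b).prefers x y ↔
      (hardB e (Function.update c i none) b).prefers x y := by
  have key : ∀ a, ¬ (b = e.symm (.low j) ∧ a = e.symm (.p i)) →
      Role.tierB (Function.update c i (some j)) (e b) (e a) =
        Role.tierB (Function.update c i none) (e b) (e a) := by
    intro a ha
    have : Role.Accepts (Function.update c i (some j)) (e b) (e a) ↔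
        Role.Accepts (Function.update c i none) (e b) (e a) := by
      rw [Equiv.eq_symm_apply, Equiv.eq_symm_apply] at ha
      revert ha
      generalize e b = r
      generalize e a = s
      intro ha
      cases r <;> cases s <;> simp_all [Role.Accepts]
      rename_i j' i'
      by_cases hii : i' = i
      · subst hii
        simpa [eq_comm] using ha
      · simp [hii]
    unfold Role.tierB
    congr 1
    by_cases hacc : Role.Accepts (Function.update c i none) (e b) (e a)
    · rw [if_pos hacc, if_pos (this.2 hacc)]
    · rw [if_neg hacc, if_neg (mt this.1 hacc)]
  have hx := key x fun h' => h ⟨h'.1, .inl h'.2⟩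
  have hy := key y fun h' => h ⟨h'.1, .inr h'.2⟩
  unfold hardB Pref.ofTier
  simp only [hx, hy]

end HardInstance

/-! ### Average number of queries needed to find all acceptors -/

section Counting

variable {A B O : Type}

open Classical in
/-- The number of queries involving `x ∈ A` that a strategy makes. -/
noncomputable def Strategy.numQueriesOf (PB : Profile B A) (x : A) : Strategy A B O → ℕ
  | .output _ => 0
  | .query b a₁ a₂ t f =>
      (if a₁ = x ∨ a₂ = x then 1 else 0) +
        if (PB b).prefers a₁ a₂ then t.numQueriesOf PB x else f.numQueriesOf PB x

/-- A single query mentions at most two agents of `A`. -/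
theorem Strategy.sum_numQueriesOf_le (PB : Profile B A) (S : Finset A) (s : Strategy A B O) :
    ∑ x ∈ S, s.numQueriesOf PB x ≤ 2 * s.numQueries PB := by
  classical
  induction s with
  | output o => simp [numQueriesOf]
  | query b a₁ a₂ t f iht ihf =>
    have h : ∑ x ∈ S, (if a₁ = x ∨ a₂ = x then 1 else 0) ≤ 2 := by
      rw [← Finset.card_filter]
      refine (Finset.card_le_card (t := {a₁, a₂}) fun x hx => ?_).trans Finset.card_le_two
      simp only [Finset.mem_filter] at hx
      simp only [Finset.mem_insert, Finset.mem_singleton]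
      tauto
    simp only [numQueriesOf, numQueries, Finset.sum_add_distrib]
    split_ifs with hp
    · omega
    · omega

variable {X P K : Type} [LinearOrder X] [DecidableEq P] (e : X ≃ Role P K)

/-- Searching for the acceptor of `p i` takes linear time on average. -/
theorem Strategy.card_mul_le_sum_numQueriesOf (c : P → Option K) (i : P) (s : Strategy X X O)
    (S : Finset K)
    (hS : ∀ j ∈ S, s.run (hardB e (Function.update c i (some j))) ≠
      s.run (hardB e (Function.update c i none))) :
    S.card * (S.card + 1) ≤
      2 * ∑ j ∈ S, s.numQueriesOf (hardB e (Function.update c i (some j))) (e.symm (.p i)) := by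
  classical
  induction s generalizing S with
  | output o =>
    have : S = ∅ := Finset.eq_empty_of_forall_notMem fun j hj => hS j hj rfl
    simp [this]
  | query b a₁ a₂ t f iht ihf =>
    -- Candidates not tested by this query get the same answer as `none`, so all of them follow the
    -- same branch and the induction hypothesis applies.
    have step : ∀ S' : Finset K, S' ⊆ S →
        (∀ j ∈ S', ¬ (b = e.symm (.low j) ∧ (a₁ = e.symm (.p i) ∨ a₂ = e.symm (.p i)))) →
        S'.card * (S'.card + 1) ≤ 2 * ∑ j ∈ S',
          if (hardB e (Function.update c i (some j)) b).prefers a₁ a₂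
          then t.numQueriesOf (hardB e (Function.update c i (some j))) (e.symm (.p i))
          else f.numQueriesOf (hardB e (Function.update c i (some j))) (e.symm (.p i)) := by
      intro S' hsub hS'
      have hans : ∀ j ∈ S', _ := fun j hj => hardB_update_prefers_iff e c i j (hS' j hj)
      by_cases hn : (hardB e (Function.update c i none) b).prefers a₁ a₂
      · refine (iht S' fun j hj => ?_).trans_eq ?_
        · have := hS j (hsub hj)
          simpa only [run, hans j hj, hn, if_true] using this
        · congr 1
          exact Finset.sum_congr rfl fun j hj => by rw [if_pos ((hans j hj).2 hn)]
      · refine (ihf S' fun j hj => ?_).trans_eq ?_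
        · have := hS j (hsub hj)
          simpa only [run, hans j hj, hn, if_false] using this
        · congr 1
          exact Finset.sum_congr rfl fun j hj => by rw [if_neg (fun h => hn ((hans j hj).1 h))]
    simp only [numQueriesOf, Finset.sum_add_distrib]
    by_cases hmem : a₁ = e.symm (.p i) ∨ a₂ = e.symm (.p i)
    -- The query eliminates at most one candidate and costs one for each `j ∈ S`; the bound closes
    -- by `s(s+1) = 2s + (s-1)s`.
    · have h1 := step (S.filter fun j => b ≠ e.symm (.low j)) (Finset.filter_subset _ _)
        (fun j hj h => (Finset.mem_filter.1 hj).2 h.1)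
      have h2 := Finset.sum_le_sum_of_subset (Finset.filter_subset (fun j => b ≠ e.symm (.low j)) S)
        (f := fun j => if (hardB e (Function.update c i (some j)) b).prefers a₁ a₂
          then t.numQueriesOf (hardB e (Function.update c i (some j))) (e.symm (.p i))
          else f.numQueriesOf (hardB e (Function.update c i (some j))) (e.symm (.p i)))
      have h3 : S.card ≤ (S.filter fun j => b ≠ e.symm (.low j)).card + 1 := by
        rw [← Finset.card_filter_add_card_filter_not (s := S) (fun j => b ≠ e.symm (.low j))]
        refine Nat.add_le_add_left (Finset.card_le_one.2 fun j hj j' hj' => ?_) _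
        simp only [Finset.mem_filter, not_not] at hj hj'
        simpa using hj.2.symm.trans hj'.2
      simp only [if_pos hmem, Finset.sum_const, smul_eq_mul, mul_one]
      nlinarith
    · simp only [if_neg hmem, Finset.sum_const_zero, zero_add]
      exact step S subset_rfl fun j _ h => hmem h.2

/-- Exchanging `c i` with `j` is an involution on the pairs `(c, j)`. Resampling one coordinate thus
preserves the uniform distribution. -/
theorem sum_sum_update {κ R : Type} [Fintype P] [Fintype κ] [AddCommMonoid R] (i : P)
    (f : (P → κ) → R) :
    ∑ c : P → κ, ∑ j, f (Function.update c i j) = Fintype.card κ • ∑ c, f c := by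
  have h : ∑ c : P → κ, ∑ _j : κ, f c = Fintype.card κ • ∑ c, f c := by
    simp [Finset.smul_sum]
  rw [← h, ← Fintype.sum_prod_type', ← Fintype.sum_prod_type']
  refine Finset.sum_nbij' (fun x => (Function.update x.1 i x.2, x.1 i))
    (fun x => (Function.update x.1 i x.2, x.1 i)) ?_ ?_ ?_ ?_ ?_ <;> simp

/-- A strategy that recognizes the hard instances in which every `p i` has an acceptor makes
quadratically many queries on average over those. -/
theorem Strategy.le_sum_numQueries [Fintype P] [Fintype K] [Nonempty K] (s : Strategy X X O) (o : O)
    (htotal : ∀ c : P → K, s.run (hardB e (some ∘ c)) = o)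
    (hnone : ∀ (c : P → Option K) (i : P), c i = none → s.run (hardB e c) ≠ o) :
    Fintype.card P * (Fintype.card K + 1) * Fintype.card (P → K) ≤
      4 * ∑ c : P → K, s.numQueries (hardB e (some ∘ c)) := by
  classical
  have hrow : ∀ i, (Fintype.card K + 1) * Fintype.card (P → K) ≤
      2 * ∑ c : P → K, s.numQueriesOf (hardB e (some ∘ c)) (e.symm (.p i)) := by
    intro i
    have hup : ∀ (c : P → K) j,
        Function.update (some ∘ c) i (some j) = some ∘ Function.update c i j :=
      fun c j => (Function.comp_update _ _ _ _).symm
    have h1 : ∀ c : P → K, Fintype.card K * (Fintype.card K + 1) ≤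
        2 * ∑ j, s.numQueriesOf (hardB e (some ∘ Function.update c i j)) (e.symm (.p i)) := by
      intro c
      have := s.card_mul_le_sum_numQueriesOf e (some ∘ c) i Finset.univ fun j _ h =>
        hnone (Function.update (some ∘ c) i none) i (by simp) (by rw [← h, hup, htotal])
      simpa only [hup, Finset.card_univ] using this
    have h2 := Finset.sum_le_sum fun (c : P → K) (_ : c ∈ Finset.univ) => h1 c
    rw [← Finset.mul_sum _ _ 2, sum_sum_update i
      fun c : P → K => s.numQueriesOf (hardB e (some ∘ c)) (e.symm (.p i))] at h2
    simp only [Finset.sum_const, Finset.card_univ, smul_eq_mul] at h2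
    refine Nat.le_of_mul_le_mul_left ?_ (Fintype.card_pos (α := K))
    calc _ = Fintype.card (P → K) * (Fintype.card K * (Fintype.card K + 1)) := by ring
      _ ≤ _ := h2
      _ = _ := by ring
  have hsum : ∀ c : P → K, ∑ i, s.numQueriesOf (hardB e (some ∘ c)) (e.symm (.p i)) ≤
      2 * s.numQueries (hardB e (some ∘ c)) := by
    intro c
    have := s.sum_numQueriesOf_le (hardB e (some ∘ c))
      (Finset.univ.image fun i : P => e.symm (Role.p i))
    rwa [Finset.sum_image (fun i _ i' _ h => by simpa using h)] at this
  calc _ = ∑ i : P, (Fintype.card K + 1) * Fintype.card (P → K) := by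
        simp [mul_assoc]
    _ ≤ ∑ i : P, 2 * ∑ c : P → K, s.numQueriesOf (hardB e (some ∘ c)) (e.symm (.p i)) :=
        Finset.sum_le_sum fun i _ => hrow i
    _ = 2 * ∑ c : P → K, ∑ i, s.numQueriesOf (hardB e (some ∘ c)) (e.symm (.p i)) := by
        rw [← Finset.mul_sum, Finset.sum_comm]
    _ ≤ 2 * ∑ c : P → K, 2 * s.numQueries (hardB e (some ∘ c)) :=
        Nat.mul_le_mul_left _ (Finset.sum_le_sum fun c _ => hsum c)
    _ = _ := by rw [← Finset.mul_sum]; ring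

end Counting

/-! ### From average cost to competitive ratios -/

section Competitive

variable {X P K : Type} [LinearOrder X] [Fintype P] [DecidableEq P] [Fintype K] [Nonempty K]
  (e : X ≃ Role P K)

theorem FindAlg.IsCorrect.le_sum_cost {alg : FindAlg X X} (h : alg.IsCorrect) :
    ((Fintype.card P * (Fintype.card K + 1) * Fintype.card (P → K) : ℕ) : ℝ≥0∞) ≤
      4 * ∑ c : P → K, alg.cost (hardA e) (hardB e (some ∘ c)) := by
  have := (alg (hardA e)).le_sum_numQueries e (Equiv.refl X)
    (fun c => (isBOptimal_hard_iff_of_total e c _).1 (h _ _))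
    (fun c i hi hrun => not_isBOptimal_refl_hard e hi (hrun ▸ h _ _))
  unfold FindAlg.cost
  exact_mod_cast this

theorem VerifyAlg.IsCorrect.le_sum_cost {alg : VerifyAlg X X} (h : alg.IsCorrect) :
    ((Fintype.card P * (Fintype.card K + 1) * Fintype.card (P → K) : ℕ) : ℝ≥0∞) ≤
      4 * ∑ c : P → K, alg.cost (hardA e) (hardB e (some ∘ c)) (Equiv.refl X) := by
  have := (alg (hardA e) (Equiv.refl X)).le_sum_numQueries e true
    (fun c => (h _ _ _).2 ((isBOptimal_hard_iff_of_total e c _).2 rfl))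
    (fun c i hi hrun => not_isBOptimal_refl_hard e hi ((h _ _ _).1 hrun))
  unfold VerifyAlg.cost
  exact_mod_cast this

/-- A lower bound on a sum of costs that holds for every algorithm in the support of a distribution
also holds for the expected costs. -/
theorem le_mul_sum_tsum_pmf {D ι : Type} [Fintype ι] (μ : PMF D) (cost : D → ι → ℝ≥0∞)
    (b k : ℝ≥0∞) (h : ∀ d ∈ μ.support, b ≤ k * ∑ c, cost d c) :
    b ≤ k * ∑ c, ∑' d, μ d * cost d c := by
  calc b = ∑' d, μ d * b := by rw [ENNReal.tsum_mul_right, μ.tsum_coe, one_mul]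
    _ ≤ ∑' d, k * ∑ c, μ d * cost d c := by
        refine ENNReal.tsum_le_tsum fun d => ?_
        by_cases hd : μ d = 0
        · simp [hd]
        · rw [← Finset.mul_sum, mul_left_comm]
          exact mul_le_mul_right (h d ((μ.mem_support_iff d).2 hd)) _
    _ = _ := by
        rw [ENNReal.tsum_mul_left, Summable.tsum_finsetSum fun _ _ => ENNReal.summable]

theorem RandFindAlg.IsCorrect.le_sum_cost {alg : RandFindAlg X X} (h : alg.IsCorrect) :
    ((Fintype.card P * (Fintype.card K + 1) * Fintype.card (P → K) : ℕ) : ℝ≥0∞) ≤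
      4 * ∑ c : P → K, alg.cost (hardA e) (hardB e (some ∘ c)) :=
  le_mul_sum_tsum_pmf alg _ _ _ fun d hd => (h d hd).le_sum_cost e

theorem RandVerifyAlg.IsCorrect.le_sum_cost {alg : RandVerifyAlg X X} (h : alg.IsCorrect) :
    ((Fintype.card P * (Fintype.card K + 1) * Fintype.card (P → K) : ℕ) : ℝ≥0∞) ≤
      4 * ∑ c : P → K, alg.cost (hardA e) (hardB e (some ∘ c)) (Equiv.refl X) :=
  le_mul_sum_tsum_pmf alg _ _ _ fun d hd => (h d hd).le_sum_cost e

/-- Competitiveness bounds each cost by `ρ * k`, hence also the average over `c`, which the lower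
bound controls. -/
theorem card_mul_le_of_sum_le (f : (P → K) → ℝ≥0∞)
    (hf : ((Fintype.card P * (Fintype.card K + 1) * Fintype.card (P → K) : ℕ) : ℝ≥0∞) ≤
      4 * ∑ c, f c) (ρ : ℝ≥0) (opt : (P → K) → ℕ∞) (k : ℕ) (hopt : ∀ c, opt c ≤ k)
    (hρ : ∀ c, f c ≤ ρ * (opt c : ℝ≥0∞)) :
    (Fintype.card P * (Fintype.card K + 1) : ℝ≥0) ≤ 4 * (ρ * k) := by
  have h1 : ∀ c, f c ≤ ((ρ * k : ℝ≥0) : ℝ≥0∞) := fun c => by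
    refine (hρ c).trans ?_
    push_cast
    gcongr
    exact_mod_cast ENat.toENNReal_mono (hopt c)
  have h2 : ((Fintype.card P * (Fintype.card K + 1) * Fintype.card (P → K) : ℕ) : ℝ≥0∞) ≤
      ((4 * (Fintype.card (P → K) * (ρ * k)) : ℝ≥0) : ℝ≥0∞) := by
    refine hf.trans ?_
    push_cast
    gcongr
    refine (Finset.sum_le_sum fun c _ => h1 c).trans_eq ?_
    rw [Finset.sum_const, Finset.card_univ, nsmul_eq_mul]
    push_cast
    rfl
  have h3 : ((Fintype.card P * (Fintype.card K + 1) * Fintype.card (P → K) : ℕ) : ℝ≥0) ≤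
      4 * (Fintype.card (P → K) * (ρ * k)) := by exact_mod_cast h2
  have hpos : (0 : ℝ≥0) < Fintype.card (P → K) := by exact_mod_cast Fintype.card_pos
  refine le_of_mul_le_mul_right ?_ hpos
  push_cast at h3 ⊢
  calc _ ≤ _ := h3
    _ = _ := by ring

end Competitive

/-! ### Choice of parameters and the final constant -/

/-- The agents of an instance of size `n` can be given the roles of a hard instance in which both
search parameters are linear in `n`. -/
theorem exists_equiv_role {n : ℕ} (hn : 4 ≤ n) : ∃ m k : ℕ, 0 < k ∧ n * n ≤ 16 * (m * (k + 1)) ∧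
    Nonempty (Fin n ≃ Role (Fin m) (Fin k)) := by
  refine ⟨n / 4, n - 2 * (n / 4) - 1, by omega, ?_, ?_⟩
  · have h1 : n ≤ 8 * (n / 4) := by omega
    have h2 : n ≤ 2 * (n - 2 * (n / 4) - 1 + 1) := by omega
    calc n * n ≤ (8 * (n / 4)) * (2 * (n - 2 * (n / 4) - 1 + 1)) := Nat.mul_le_mul h1 h2
      _ = _ := by ring
  · refine ⟨(Fintype.equivOfCardEq ?_).trans Role.equivSum.symm⟩
    simp only [Fintype.card_fin, Fintype.card_sum, Fintype.card_option]
    omega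

end StableQuery

theorem mainTheorem2 :
    ∃ c : ℝ≥0, 0 < c ∧ ∃ N : ℕ, ∀ n : ℕ, N ≤ n →
      (∀ alg : StableQuery.FindAlg (Fin n) (Fin n),
        StableQuery.FindAlg.IsCorrect alg →
          (c : ℝ≥0∞) * (n : ℝ≥0∞) ≤
            StableQuery.findRatio (StableQuery.FindAlg.cost alg)) ∧
      (∀ alg : StableQuery.RandFindAlg (Fin n) (Fin n),
        StableQuery.RandFindAlg.IsCorrect alg →
          (c : ℝ≥0∞) * (n : ℝ≥0∞) ≤
            StableQuery.findRatio (StableQuery.RandFindAlg.cost alg)) ∧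
      (∀ alg : StableQuery.VerifyAlg (Fin n) (Fin n),
        StableQuery.VerifyAlg.IsCorrect alg →
          (c : ℝ≥0∞) * (n : ℝ≥0∞) ≤
            StableQuery.verifyRatio (StableQuery.VerifyAlg.cost alg)) ∧
      (∀ alg : StableQuery.RandVerifyAlg (Fin n) (Fin n),
        StableQuery.RandVerifyAlg.IsCorrect alg →
          (c : ℝ≥0∞) * (n : ℝ≥0∞) ≤
            StableQuery.verifyRatio (StableQuery.RandVerifyAlg.cost alg)) := by
  -- The constant is `128 = 16 * 4 * 2`: the loss in `n * n ≤ 16 * (m * (k + 1))`, the factor from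
  -- averaging, and the certificate size `2n`.
  refine ⟨1 / 128, by norm_num, 4, fun n hn => ?_⟩
  obtain ⟨m, k, hk, hmk, ⟨e⟩⟩ := StableQuery.exists_equiv_role hn
  have : Nonempty (Fin k) := ⟨⟨0, hk⟩⟩
  have final : ∀ ρ : ℝ≥0, ((Fintype.card (Fin m) : ℝ≥0) * (Fintype.card (Fin k) + 1) ≤
      4 * (ρ * (2 * Fintype.card (Fin n) : ℕ))) →
      ((1 / 128 : ℝ≥0) : ℝ≥0∞) * (n : ℝ≥0∞) ≤ (ρ : ℝ≥0∞) := by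
    intro ρ h
    simp only [Fintype.card_fin] at h
    push_cast at h
    have hmk' : (n : ℝ≥0) * n ≤ 16 * (m * (k + 1)) := by exact_mod_cast hmk
    have hn' : (0 : ℝ≥0) < n := by
      have : 0 < n := by omega
      exact_mod_cast this
    have : (1 / 128 : ℝ≥0) * n ≤ ρ := by
      refine le_of_mul_le_mul_right ?_ hn'
      calc (1 / 128 : ℝ≥0) * n * n = 1 / 128 * (n * n) := by ring
        _ ≤ 1 / 128 * (16 * (m * (k + 1))) := by gcongr
        _ ≤ 1 / 128 * (16 * (4 * (ρ * (2 * n)))) := by gcongr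
        _ = ρ * n := by ring
    exact_mod_cast this
  refine ⟨fun alg h => ?_, fun alg h => ?_, fun alg h => ?_, fun alg h => ?_⟩
  · exact le_iInf₂ fun ρ hρ => final ρ <|
      StableQuery.card_mul_le_of_sum_le _ (h.le_sum_cost e) ρ _ _
        (StableQuery.optFind_hard_le e) fun c => hρ _ _
  · exact le_iInf₂ fun ρ hρ => final ρ <|
      StableQuery.card_mul_le_of_sum_le _ (h.le_sum_cost e) ρ _ _
        (StableQuery.optFind_hard_le e) fun c => hρ _ _
  · exact le_iInf₂ fun ρ hρ => final ρ <|
      StableQuery.card_mul_le_of_sum_le _ (h.le_sum_cost e) ρ _ _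
        (StableQuery.optVerify_hard_le e) fun c =>
          hρ _ _ _ ((StableQuery.isBOptimal_hard_iff_of_total e c _).2 rfl)
  · exact le_iInf₂ fun ρ hρ => final ρ <|
      StableQuery.card_mul_le_of_sum_le _ (h.le_sum_cost e) ρ _ _
        (StableQuery.optVerify_hard_le e) fun c =>
          hρ _ _ _ ((StableQuery.isBOptimal_hard_iff_of_total e c _).2 rfl)
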